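/- There is an absolute constant $K>0$ with the following property. Let $H$ be a finite-dimensional complex Hilbert space, with inner product linear in the first argument, let $\{x_k\}_{k=1}^n$ and $\{y_k\}_{k=1}^n$ be finite sequences of vectors in $H$, and let $C>0$ be such that $$\Big\|\sum_{k=1}^n \varepsilon_k\langle u,y_k\rangle x_k\Big\|\le C\|u\|\quad\text{for all } u\in H \text{ and all } \varepsilon_1,\dots,\varepsilon_n\in\mathbb{C} \text{ with } |\varepsilon_k|\le 1.$$ Then there are nonzero complex numbers $\alpha_1,\dots,\alpha_n$ such that both $\{\alpha_k x_k\}_{k=1}^n$ and $\{\overline{\alpha_k}^{\,-1}y_k\}_{k=1}^n$ are $CK$-Bessel, that is, for every $u\in H$, $$\sum_{k=1}^n|\langle u,\alpha_k x_k\rangle|^2\le CK\|u\|^2\quad\text{and}\quad \sum_{k=1}^n|\langle u,\overline{\alpha_k}^{\,-1}y_k\rangle|^2\le CK\|u\|^2 .$$ -/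

import Mathlib

/-- A finite family `x` of vectors in a complex Hilbert space `H` is `B`-Bessel if
`∑ₖ |⟨u, xₖ⟩|² ≤ B ‖u‖²` for every `u ∈ H`. Mathlib's inner product is linear in its second
argument, so the product `⟨u, v⟩` that is linear in `u` is `inner ℂ v u`. -/
def IsBessel {ι H : Type*} [Fintype ι] [NormedAddCommGroup H] [InnerProductSpace ℂ H]
    (B : ℝ) (x : ι → H) : Prop :=
  ∀ u : H, ∑ k, ‖inner ℂ (x k) u‖ ^ 2 ≤ B * ‖u‖ ^ 2

/-! Aligning phases gives `∑ |⟨v, xₖ⟩| |⟨u, yₖ⟩| ≤ C ‖v‖ ‖u‖`. Averaging over random sign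
combinations of vectors and applying Khintchine upgrades this to `∑ √pₖ √qₖ ≤ 4C` for all `p`, `q`
in the convex sets `diagonalHull x`, `diagonalHull y`. On convex sets such a bound yields weights:
at a maximiser of a slightly perturbed sum, the first-order conditions linearise it in `p` and in
`q` separately, with mutually inverse weights `tₖ`, `tₖ⁻¹`. Then `αₖ = √tₖ`. -/

/-- The mean of `f (∑ ± vᵢ)` over all choices of signs, `vᵢ` running through the list `l`. -/
noncomputable def signMean {E : Type*} [AddCommGroup E] : List E → (E → ℝ) → ℝ
  | [], f => f 0
  | v :: l, f => (signMean l (fun z => f (z + v)) + signMean l (fun z => f (z - v))) / 2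

section SignMean

variable {E F : Type*} [AddCommGroup E] [AddCommGroup F]

theorem signMean_mono (l : List E) {f g : E → ℝ} (h : ∀ z, f z ≤ g z) :
    signMean l f ≤ signMean l g := by
  induction l generalizing f g with
  | nil => exact h 0
  | cons v l ih =>
    have h1 := ih (f := fun z => f (z + v)) (g := fun z => g (z + v)) fun z => h _
    have h2 := ih (f := fun z => f (z - v)) (g := fun z => g (z - v)) fun z => h _
    simp only [signMean]
    linarith

theorem signMean_add (l : List E) (f g : E → ℝ) :
    signMean l (fun z => f z + g z) = signMean l f + signMean l g := by
  induction l generalizing f g with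
  | nil => rfl
  | cons v l ih =>
    simp only [signMean]
    rw [ih (fun z => f (z + v)), ih (fun z => f (z - v))]
    ring

theorem signMean_const (l : List E) (c : ℝ) : signMean l (fun _ => c) = c := by
  induction l with
  | nil => rfl
  | cons v l ih =>
    simp only [signMean, ih]
    ring

theorem signMean_const_mul (l : List E) (c : ℝ) (f : E → ℝ) :
    signMean l (fun z => c * f z) = c * signMean l f := by
  induction l generalizing f with
  | nil => rfl
  | cons v l ih =>
    simp only [signMean]
    rw [ih (fun z => f (z + v)), ih (fun z => f (z - v))]
    ring

theorem signMean_sum {ι : Type*} (s : Finset ι) (l : List E) (f : ι → E → ℝ) :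
    signMean l (fun z => ∑ i ∈ s, f i z) = ∑ i ∈ s, signMean l (f i) := by
  classical
  induction s using Finset.induction_on with
  | empty => simpa using signMean_const l 0
  | insert a s ha ih => simp only [Finset.sum_insert ha, signMean_add, ih]

theorem signMean_comp (T : E →+ F) (l : List E) (f : F → ℝ) :
    signMean l (fun z => f (T z)) = signMean (l.map T) f := by
  induction l generalizing f with
  | nil => simp [signMean]
  | cons v l ih =>
    simp only [signMean, List.map_cons, map_add, map_sub]
    rw [ih (fun z => f (z + T v)), ih (fun z => f (z - T v))]

end SignMean

/-! ### Moments of random sign sums -/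

theorem signMean_norm_sq {H : Type*} [NormedAddCommGroup H] [InnerProductSpace ℂ H] (l : List H) :
    signMean l (fun z => ‖z‖ ^ 2) = (l.map fun v => ‖v‖ ^ 2).sum := by
  induction l with
  | nil => simp [signMean]
  | cons v l ih =>
    have h : ∀ z : H, ‖z + v‖ ^ 2 + ‖z - v‖ ^ 2 = 2 * ‖z‖ ^ 2 + 2 * ‖v‖ ^ 2 := fun z => by
      have := parallelogram_law_with_norm ℂ z v
      linarith
    simp only [signMean, List.map_cons, List.sum_cons]
    rw [← signMean_add]
    simp only [h]
    rw [signMean_add, signMean_const_mul, signMean_const, ih]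
    ring

theorem signMean_norm_pow_four_le (l : List ℂ) :
    signMean l (fun z => ‖z‖ ^ 4) ≤ 3 * ((l.map fun v => ‖v‖ ^ 2).sum) ^ 2 := by
  induction l with
  | nil => simp [signMean]
  | cons v l ih =>
    -- The left side is `2(‖z‖² + ‖v‖²)² + 8 Re(z v̄)²`; Cauchy–Schwarz gives the 12.
    have h : ∀ z : ℂ, ‖z + v‖ ^ 4 + ‖z - v‖ ^ 4 ≤
        (2 * ‖z‖ ^ 4 + (12 * ‖v‖ ^ 2) * ‖z‖ ^ 2) + 2 * ‖v‖ ^ 4 := fun z => by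
      have e : ∀ w : ℂ, ‖w‖ ^ 2 = w.re ^ 2 + w.im ^ 2 := fun w => by
        rw [← Complex.normSq_eq_norm_sq, Complex.normSq_apply]; ring
      have e4 : ∀ w : ℂ, ‖w‖ ^ 4 = (w.re ^ 2 + w.im ^ 2) ^ 2 := fun w => by rw [← e]; ring
      rw [e4, e4, e4, e4, e, e]
      simp only [Complex.add_re, Complex.add_im, Complex.sub_re, Complex.sub_im]
      nlinarith [sq_nonneg (z.re * v.im - z.im * v.re)]
    have hm := signMean_mono l h
    rw [signMean_add, signMean_add, signMean_add, signMean_const_mul, signMean_const_mul,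
      signMean_const, signMean_norm_sq] at hm
    simp only [signMean, List.map_cons, List.sum_cons]
    nlinarith [sq_nonneg (‖v‖ ^ 2)]

/-- Khintchine's inequality between the first and the second moment, with constant `1/2`. -/
theorem sqrt_le_two_mul_signMean_norm (l : List ℂ) :
    √((l.map fun v => ‖v‖ ^ 2).sum) ≤ 2 * signMean l (fun z => ‖z‖) := by
  set S := (l.map fun v => ‖v‖ ^ 2).sum with hS
  have hnn : 0 ≤ signMean l (fun z => ‖z‖) := by
    simpa [signMean_const] using signMean_mono l (f := fun _ => 0) fun z : ℂ => norm_nonneg z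
  rcases le_or_gt S 0 with h0 | hpos
  · rw [Real.sqrt_eq_zero_of_nonpos h0]; positivity
  set s := √S with hs
  have hs0 : 0 < s := Real.sqrt_pos.2 hpos
  have hsS : s ^ 2 = S := Real.sq_sqrt hpos.le
  -- With the fourth moment at most `3s⁴`, the coefficient `1/6` costs half of the main term `s⁴`,
  -- whence the factor 2.
  have key : ∀ z : ℂ, (s ^ 2 * ‖z‖ ^ 2 + (-(1 / 6)) * ‖z‖ ^ 4) ≤ s ^ 3 * ‖z‖ := fun z => by
    have hr := norm_nonneg z
    have : s ^ 2 * ‖z‖ - (1 / 6) * ‖z‖ ^ 3 ≤ s ^ 3 := by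
      nlinarith [mul_nonneg (add_nonneg hr hs0.le) (sq_nonneg (‖z‖ - 3 / 2 * s)),
        mul_nonneg hr (sq_nonneg (‖z‖ - 3 / 2 * s)), mul_nonneg hs0.le (sq_nonneg (‖z‖ - 3 / 2 * s)),
        pow_pos hs0 3, pow_nonneg hr 3]
    nlinarith
  have hm := signMean_mono l key
  rw [signMean_add, signMean_const_mul, signMean_const_mul, signMean_const_mul,
    signMean_norm_sq, ← hS] at hm
  have h4 := signMean_norm_pow_four_le l
  rw [← hS, ← hsS] at h4
  rw [← hsS] at hm
  have h5 : s ^ 3 * s ≤ s ^ 3 * (2 * signMean l (fun z => ‖z‖)) := by nlinarith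
  exact le_of_mul_le_mul_left h5 (by positivity)

theorem signMean_norm_le_one {H : Type*} [NormedAddCommGroup H] [InnerProductSpace ℂ H]
    {l : List H} (h : (l.map fun v => ‖v‖ ^ 2).sum ≤ 1) : signMean l (fun z => ‖z‖) ≤ 1 := by
  have hm := signMean_mono l (f := fun z => ‖z‖) (g := fun z => 1 / 2 * ‖z‖ ^ 2 + 1 / 2)
    fun z => by nlinarith [sq_nonneg (‖z‖ - 1)]
  rw [signMean_add, signMean_const_mul, signMean_const, signMean_norm_sq] at hm
  linarith

/-! ### From the multiplier bound to convex hulls -/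

section Hilbert

variable {ι H : Type*} [NormedAddCommGroup H] [InnerProductSpace ℂ H]

theorem sum_norm_inner_mul_le [Fintype ι] {x y : ι → H} {C : ℝ}
    (hC : ∀ (u : H) (ε : ι → ℂ), (∀ k, ‖ε k‖ ≤ 1) →
      ‖∑ k, (ε k * inner ℂ (y k) u) • x k‖ ≤ C * ‖u‖) (v u : H) :
    ∑ k, ‖inner ℂ (x k) v‖ * ‖inner ℂ (y k) u‖ ≤ C * ‖v‖ * ‖u‖ := by
  have phase : ∀ z : ℂ, ∃ e : ℂ, ‖e‖ ≤ 1 ∧ e * z = (‖z‖ : ℂ) := fun z => by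
    rcases eq_or_ne z 0 with rfl | hz
    · exact ⟨0, by simp, by simp⟩
    · refine ⟨‖z‖ / z, by simp [hz], by field_simp⟩
  choose e he hez using fun k => phase (inner ℂ (y k) u * inner ℂ v (x k))
  have h1 : inner ℂ v (∑ k, (e k * inner ℂ (y k) u) • x k) =
      ((∑ k, ‖inner ℂ (x k) v‖ * ‖inner ℂ (y k) u‖ : ℝ) : ℂ) := by
    rw [inner_sum, Complex.ofReal_sum]
    refine Finset.sum_congr rfl fun k _ => ?_
    rw [inner_smul_right, mul_assoc, hez, norm_mul, norm_inner_symm v, mul_comm]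
  have h2 := norm_inner_le_norm (𝕜 := ℂ) v (∑ k, (e k * inner ℂ (y k) u) • x k)
  rw [h1, Complex.norm_real] at h2
  calc _ ≤ _ := Real.le_norm_self _
    _ ≤ _ := h2
    _ ≤ ‖v‖ * (C * ‖u‖) := by gcongr; exact hC u e he
    _ = _ := by ring

/-- Khintchine replaces each square root by twice a mean. The means over `l` and `m` are
independent, so the bilinear bound is averaged in one variable, then the other. -/
theorem sum_sqrt_mul_sqrt_le_of_list [Fintype ι] {x y : ι → H} {C : ℝ} (hC0 : 0 ≤ C)
    (hC : ∀ v u : H, ∑ k, ‖inner ℂ (x k) v‖ * ‖inner ℂ (y k) u‖ ≤ C * ‖v‖ * ‖u‖)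
    {l m : List H} (hl : (l.map fun v => ‖v‖ ^ 2).sum ≤ 1)
    (hm : (m.map fun v => ‖v‖ ^ 2).sum ≤ 1) :
    ∑ k, √((l.map fun v => ‖inner ℂ (x k) v‖ ^ 2).sum) *
      √((m.map fun v => ‖inner ℂ (y k) v‖ ^ 2).sum) ≤ 4 * C := by
  have kh : ∀ (a : H) (l : List H), √((l.map fun v => ‖inner ℂ a v‖ ^ 2).sum) ≤
      2 * signMean l (fun z => ‖inner ℂ a z‖) := fun a l => by
    have := sqrt_le_two_mul_signMean_norm (l.map (innerSL ℂ a).toLinearMap.toAddMonoidHom)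
    rw [← signMean_comp] at this
    simpa [Function.comp_def] using this
  have hcol : ∀ u : H, ∑ k, signMean l (fun v => ‖inner ℂ (x k) v‖) * ‖inner ℂ (y k) u‖
      ≤ C * ‖u‖ := fun u => by
    have h1 := signMean_mono l (f := fun v => ∑ k, ‖inner ℂ (y k) u‖ * ‖inner ℂ (x k) v‖)
      (g := fun v => (C * ‖u‖) * ‖v‖) fun v => by
        simpa only [mul_comm, mul_left_comm, mul_assoc] using hC v u
    rw [signMean_sum, signMean_const_mul] at h1
    simp only [signMean_const_mul] at h1
    calc _ = _ := Finset.sum_congr rfl fun k _ => mul_comm _ _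
      _ ≤ _ := h1
      _ ≤ (C * ‖u‖) * 1 := by gcongr; exact signMean_norm_le_one hl
      _ = _ := mul_one _
  have htot : ∑ k, signMean l (fun v => ‖inner ℂ (x k) v‖) *
      signMean m (fun u => ‖inner ℂ (y k) u‖) ≤ C := by
    have h1 := signMean_mono m hcol
    rw [signMean_sum, signMean_const_mul] at h1
    simp only [signMean_const_mul] at h1
    calc _ ≤ _ := h1
      _ ≤ C * 1 := by gcongr; exact signMean_norm_le_one hm
      _ = _ := mul_one _
  calc _ ≤ ∑ k, (2 * signMean l (fun v => ‖inner ℂ (x k) v‖)) *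
        (2 * signMean m (fun u => ‖inner ℂ (y k) u‖)) :=
        Finset.sum_le_sum fun k _ => mul_le_mul (kh _ _) (kh _ _) (Real.sqrt_nonneg _)
          ((Real.sqrt_nonneg _).trans (kh _ _))
    _ = 4 * ∑ k, signMean l (fun v => ‖inner ℂ (x k) v‖) *
      signMean m (fun u => ‖inner ℂ (y k) u‖) := by
        rw [Finset.mul_sum]; exact Finset.sum_congr rfl fun k _ => by ring
    _ ≤ _ := by gcongr

/-- The vectors `(tr (ρ xₖ ⊗ xₖ))ₖ`, where `ρ` is positive and of trace at most one. -/
def diagonalHull (x : ι → H) : Set (ι → ℝ) :=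
  convexHull ℝ ((fun v k => ‖inner ℂ (x k) v‖ ^ 2) '' Metric.closedBall (0 : H) 1)

theorem exists_list_of_mem_diagonalHull {x : ι → H} {p : ι → ℝ} (hp : p ∈ diagonalHull x) :
    ∃ l : List H, (l.map fun v => ‖v‖ ^ 2).sum ≤ 1 ∧
      ∀ k, p k = (l.map fun v => ‖inner ℂ (x k) v‖ ^ 2).sum := by
  obtain ⟨κ, _, w, z, hw, hw1, hz, rfl⟩ := mem_convexHull_iff_exists_fintype.1 hp
  choose v hv hvz using hz
  have hsq : ∀ i, √(w i) ^ 2 = w i := fun i => Real.sq_sqrt (hw i)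
  -- Weights are absorbed into the vectors as `√wᵢ`.
  refine ⟨Finset.univ.toList.map fun i => (√(w i) : ℂ) • v i, ?_, fun k => ?_⟩
  · rw [List.map_map, Finset.sum_map_toList, ← hw1]
    refine Finset.sum_le_sum fun i _ => ?_
    have h1 : ‖v i‖ ≤ 1 := by simpa using hv i
    simp only [Function.comp_apply, norm_smul, mul_pow, Complex.norm_real, Real.norm_eq_abs,
      sq_abs, hsq]
    exact mul_le_of_le_one_right (hw i) (pow_le_one₀ (norm_nonneg _) h1)
  · rw [List.map_map, Finset.sum_map_toList, Finset.sum_apply]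
    refine Finset.sum_congr rfl fun i _ => ?_
    simp only [Function.comp_apply, inner_smul_right, norm_mul, mul_pow, Complex.norm_real,
      Real.norm_eq_abs, sq_abs, hsq, ← hvz, Pi.smul_apply, smul_eq_mul]

theorem isBounded_diagonalHull [Fintype ι] [FiniteDimensional ℂ H] (x : ι → H) :
    Bornology.IsBounded (diagonalHull x) := by
  have : ProperSpace H := FiniteDimensional.proper ℂ H
  refine isBounded_convexHull.2 ((isCompact_closedBall _ _).image ?_).isBounded
  fun_prop

theorem mem_diagonalHull (x : ι → H) {v : H} (hv : ‖v‖ ≤ 1) :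
    (fun k => ‖inner ℂ (x k) v‖ ^ 2) ∈ diagonalHull x :=
  subset_convexHull ℝ _ ⟨v, by simpa using hv, rfl⟩

theorem isBessel_smul_of_diagonalHull [Fintype ι] {x : ι → H} {B : ℝ} {c : ι → ℂ}
    (h : ∀ p ∈ diagonalHull x, ∑ k, ‖c k‖ ^ 2 * p k ≤ B) (u : H) :
    ∑ k, ‖inner ℂ (c k • x k) u‖ ^ 2 ≤ B * ‖u‖ ^ 2 := by
  rcases eq_or_ne u 0 with rfl | hu
  · simp
  have hu' : (‖u‖ : ℂ) ≠ 0 := by simpa using hu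
  have h1 := h _ (mem_diagonalHull x (v := (‖u‖ : ℂ)⁻¹ • u) (by simp [norm_smul, hu]))
  calc _ = (∑ k, ‖c k‖ ^ 2 * ‖inner ℂ (x k) ((‖u‖ : ℂ)⁻¹ • u)‖ ^ 2) * ‖u‖ ^ 2 := by
        rw [Finset.sum_mul]
        refine Finset.sum_congr rfl fun k _ => ?_
        have : ‖u‖ ≠ 0 := by simpa using hu
        simp only [inner_smul_left, inner_smul_right, norm_mul, norm_inv, RCLike.norm_conj,
          Complex.norm_real, norm_norm]
        field_simp
    _ ≤ _ := by gcongr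

end Hilbert

/-! ### Weights from a maximiser -/

section Optimisation

theorem sqrt_add_le_sqrt_add_sqrt {a b : ℝ} (ha : 0 ≤ a) (hb : 0 ≤ b) :
    √(a + b) ≤ √a + √b := by
  refine Real.sqrt_le_iff.2 ⟨by positivity, ?_⟩
  nlinarith [Real.sq_sqrt ha, Real.sq_sqrt hb, Real.sqrt_nonneg a, Real.sqrt_nonneg b,
    mul_nonneg (Real.sqrt_nonneg a) (Real.sqrt_nonneg b)]

variable {ι : Type*} [Fintype ι]

/-- The derivative from `p₀` towards `p` cannot be positive at a maximum; `δ` keeps the square roots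
differentiable there. -/
theorem sum_div_sqrt_mul_le_of_isMaxOn {A : Set (ι → ℝ)} (hA : Convex ℝ A)
    (hA0 : ∀ p ∈ A, ∀ k, 0 ≤ p k) {c : ι → ℝ} {δ : ℝ} (hδ : 0 < δ) {p₀ : ι → ℝ} (hp₀ : p₀ ∈ A)
    (hmax : IsMaxOn (fun p => ∑ k, √(p k + δ) * c k) A p₀) {p : ι → ℝ} (hp : p ∈ A) :
    ∑ k, c k / √(p₀ k + δ) * p k ≤ ∑ k, c k / √(p₀ k + δ) * p₀ k := by
  have hpos : ∀ k, 0 < p₀ k + δ := fun k => add_pos_of_nonneg_of_pos (hA0 _ hp₀ k) hδ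
  have hd : HasDerivAt (fun s : ℝ => ∑ k, √(p₀ k + s * (p k - p₀ k) + δ) * c k)
      (∑ k, (p k - p₀ k) / (2 * √(p₀ k + δ)) * c k) 0 := by
    refine HasDerivAt.fun_sum fun k _ => HasDerivAt.mul_const ?_ _
    have h1 : HasDerivAt (fun s : ℝ => p₀ k + s * (p k - p₀ k) + δ) (p k - p₀ k) 0 := by
      simpa using (((hasDerivAt_id (0 : ℝ)).mul_const (p k - p₀ k)).const_add (p₀ k)).add_const δ
    simpa using h1.sqrt (by simpa using (hpos k).ne')
  have hle : ∑ k, (p k - p₀ k) / (2 * √(p₀ k + δ)) * c k ≤ 0 := by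
    have hs := (hasDerivAt_iff_tendsto_slope.1 hd).mono_left
      (nhdsWithin_mono (0 : ℝ) (s := Set.Ioi 0) fun s hs => (ne_of_gt hs : s ≠ 0))
    refine le_of_tendsto hs ?_
    filter_upwards [Ioo_mem_nhdsGT (zero_lt_one' ℝ)] with s hs
    have hmem : (fun k => p₀ k + s * (p k - p₀ k)) ∈ A := by
      have := hA.add_smul_sub_mem hp₀ hp ⟨hs.1.le, hs.2.le⟩
      exact this
    have := hmax hmem
    simp only [Set.mem_ofPred_eq] at this
    rw [slope_def_field]
    refine div_nonpos_of_nonpos_of_nonneg ?_ (by linarith [hs.1])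
    simpa using this
  have e : ∑ k, c k / √(p₀ k + δ) * p k - ∑ k, c k / √(p₀ k + δ) * p₀ k =
      2 * ∑ k, (p k - p₀ k) / (2 * √(p₀ k + δ)) * c k := by
    rw [← Finset.sum_sub_distrib, Finset.mul_sum]
    refine Finset.sum_congr rfl fun k _ => ?_
    have := (Real.sqrt_pos.2 (hpos k)).ne'
    field_simp
  linarith

theorem exists_pos_sum_sqrt_add_le {A B : Set (ι → ℝ)} (hA : IsCompact A) (hB : IsCompact B)
    (hA0 : ∀ p ∈ A, ∀ k, 0 ≤ p k) (hB0 : ∀ q ∈ B, ∀ k, 0 ≤ q k)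
    {M N : ℝ} (hMN : M < N) (hM : ∀ p ∈ A, ∀ q ∈ B, ∑ k, √(p k) * √(q k) ≤ M) :
    ∃ δ > 0, ∀ p ∈ A, ∀ q ∈ B, ∑ k, √(p k + δ) * √(q k + δ) ≤ N := by
  obtain ⟨R, hR⟩ := hA.isBounded.exists_norm_le
  obtain ⟨S, hS⟩ := hB.isBounded.exists_norm_le
  have hcont : Continuous fun δ : ℝ => ∑ _k : ι, √δ * (√R + √S + √δ) := by fun_prop
  have hev : ∀ᶠ δ in nhdsWithin (0 : ℝ) (Set.Ioi 0),
      ∑ _k : ι, √δ * (√R + √S + √δ) < N - M :=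
    (hcont.continuousAt.eventually (gt_mem_nhds (by simpa using hMN))).filter_mono
      nhdsWithin_le_nhds
  obtain ⟨δ, hδ, hδ0⟩ := (hev.and self_mem_nhdsWithin).exists
  refine ⟨δ, hδ0, fun p hp q hq => ?_⟩
  have hterm : ∀ k, √(p k + δ) * √(q k + δ) ≤ √(p k) * √(q k) + √δ * (√R + √S + √δ) := fun k => by
    have hpR : √(p k) ≤ √R := Real.sqrt_le_sqrt
      ((Real.le_norm_self _).trans ((norm_le_pi_norm p k).trans (hR p hp)))
    have hqS : √(q k) ≤ √S := Real.sqrt_le_sqrt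
      ((Real.le_norm_self _).trans ((norm_le_pi_norm q k).trans (hS q hq)))
    have := mul_le_mul (sqrt_add_le_sqrt_add_sqrt (hA0 p hp k) (le_of_lt hδ0))
      (sqrt_add_le_sqrt_add_sqrt (hB0 q hq k) (le_of_lt hδ0)) (Real.sqrt_nonneg _)
      (by positivity)
    nlinarith [Real.sqrt_nonneg δ]
  have := Finset.sum_le_sum fun k (_ : k ∈ Finset.univ) => hterm k
  rw [Finset.sum_add_distrib] at this
  linarith [hM p hp q hq]

theorem exists_weights_of_sum_sqrt_le_of_isCompact {A B : Set (ι → ℝ)} (hA : IsCompact A) (hB : IsCompact B)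
    (hAc : Convex ℝ A) (hBc : Convex ℝ B) (hAn : A.Nonempty) (hBn : B.Nonempty)
    (hA0 : ∀ p ∈ A, ∀ k, 0 ≤ p k) (hB0 : ∀ q ∈ B, ∀ k, 0 ≤ q k)
    {M N : ℝ} (hMN : M < N) (hM : ∀ p ∈ A, ∀ q ∈ B, ∑ k, √(p k) * √(q k) ≤ M) :
    ∃ t : ι → ℝ, (∀ k, 0 < t k) ∧ (∀ p ∈ A, ∑ k, t k * p k ≤ N) ∧
      ∀ q ∈ B, ∑ k, (t k)⁻¹ * q k ≤ N := by
  obtain ⟨δ, hδ, hN⟩ := exists_pos_sum_sqrt_add_le hA hB hA0 hB0 hMN hM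
  have hcont : Continuous fun z : (ι → ℝ) × (ι → ℝ) => ∑ k, √(z.1 k + δ) * √(z.2 k + δ) := by
    fun_prop
  obtain ⟨⟨p₀, q₀⟩, ⟨hp₀, hq₀⟩, hmax⟩ :=
    (hA.prod hB).exists_isMaxOn (hAn.prod hBn) hcont.continuousOn
  have hp : ∀ k, 0 < √(p₀ k + δ) := fun k => Real.sqrt_pos.2 (by linarith [hA0 _ hp₀ k])
  have hq : ∀ k, 0 < √(q₀ k + δ) := fun k => Real.sqrt_pos.2 (by linarith [hB0 _ hq₀ k])
  have hbound : ∀ {a b : ι → ℝ}, (∀ k, 0 ≤ a k) → (∀ k, 0 ≤ b k) →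
      ∑ k, √(b k + δ) / √(a k + δ) * a k ≤ ∑ k, √(a k + δ) * √(b k + δ) := fun {a b} ha hb =>
    Finset.sum_le_sum fun k _ => by
      have h1 : 0 < a k + δ := by linarith [ha k]
      have h2 : 0 < √(a k + δ) := Real.sqrt_pos.2 h1
      rw [div_mul_eq_mul_div, div_le_iff₀ h2]
      have := Real.mul_self_sqrt h1.le
      nlinarith [Real.sqrt_nonneg (b k + δ), mul_nonneg (Real.sqrt_nonneg (b k + δ)) hδ.le]
  -- `δ` also keeps these ratios finite and positive. Joint maximality implies maximality in each
  -- variable, and exchanging the roles inverts the ratio.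
  refine ⟨fun k => √(q₀ k + δ) / √(p₀ k + δ), fun k => div_pos (hq k) (hp k), fun p hpA => ?_,
    fun q hqB => ?_⟩
  · refine (sum_div_sqrt_mul_le_of_isMaxOn hAc hA0 hδ hp₀ (fun p hpA => ?_) hpA).trans
      ((hbound (hA0 _ hp₀) (hB0 _ hq₀)).trans (hN _ hp₀ _ hq₀))
    exact hmax (Set.mk_mem_prod hpA hq₀)
  · simp only [inv_div]
    refine (sum_div_sqrt_mul_le_of_isMaxOn hBc hB0 hδ hq₀ (fun q hqB => ?_) hqB).trans
      ((hbound (hB0 _ hq₀) (hA0 _ hp₀)).trans ?_)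
    · have hle := hmax (Set.mk_mem_prod hp₀ hqB)
      simp only [Set.mem_ofPred_eq] at hle ⊢
      simpa only [mul_comm] using hle
    · simpa only [mul_comm] using hN _ hp₀ _ hq₀

/-- A bound for the geometric means of points of two bounded convex sets is, up to any loss,
witnessed by a pair of mutually inverse weights. -/
theorem exists_weights_of_sum_sqrt_le {A B : Set (ι → ℝ)} (hA : Bornology.IsBounded A)
    (hB : Bornology.IsBounded B) (hAc : Convex ℝ A) (hBc : Convex ℝ B) (hAn : A.Nonempty)
    (hBn : B.Nonempty) (hA0 : ∀ p ∈ A, ∀ k, 0 ≤ p k) (hB0 : ∀ q ∈ B, ∀ k, 0 ≤ q k)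
    {M N : ℝ} (hMN : M < N) (hM : ∀ p ∈ A, ∀ q ∈ B, ∑ k, √(p k) * √(q k) ≤ M) :
    ∃ t : ι → ℝ, (∀ k, 0 < t k) ∧ (∀ p ∈ A, ∑ k, t k * p k ≤ N) ∧
      ∀ q ∈ B, ∑ k, (t k)⁻¹ * q k ≤ N := by
  have hnn : ∀ {S : Set (ι → ℝ)}, (∀ p ∈ S, ∀ k, 0 ≤ p k) → ∀ p ∈ closure S, ∀ k, 0 ≤ p k :=
    fun {S} h p hp k => closure_minimal (t := {p : ι → ℝ | 0 ≤ p k}) (fun p hp => h p hp k)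
      (isClosed_le continuous_const (continuous_apply k)) hp
  have hM' : ∀ p ∈ closure A, ∀ q ∈ closure B, ∑ k, √(p k) * √(q k) ≤ M := fun p hp q hq =>
    isClosed_Iic.closure_subset (map_mem_closure₂ (f := fun p q : ι → ℝ => ∑ k, √(p k) * √(q k))
      (u := Set.Iic M) (by unfold Function.uncurry; fun_prop) hp hq hM)
  obtain ⟨t, ht, h1, h2⟩ := exists_weights_of_sum_sqrt_le_of_isCompact hA.isCompact_closure
    hB.isCompact_closure hAc.closure hBc.closure hAn.closure hBn.closure (hnn hA0) (hnn hB0)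
    hMN hM'
  exact ⟨t, ht, fun p hp => h1 p (subset_closure hp), fun q hq => h2 q (subset_closure hq)⟩

end Optimisation

theorem theorem2p2 :
    ∃ K : ℝ, 0 < K ∧
      ∀ (H : Type*) [NormedAddCommGroup H] [InnerProductSpace ℂ H] [FiniteDimensional ℂ H]
        (n : ℕ) (x y : Fin n → H) (C : ℝ), 0 < C →
        (∀ (u : H) (ε : Fin n → ℂ), (∀ k, ‖ε k‖ ≤ 1) →
          ‖∑ k, (ε k * inner ℂ (y k) u) • x k‖ ≤ C * ‖u‖) →
        ∃ α : Fin n → ℂ, (∀ k, α k ≠ 0) ∧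
          IsBessel (C * K) (fun k => α k • x k) ∧
          IsBessel (C * K) (fun k => (starRingEnd ℂ (α k))⁻¹ • y k) := by
  -- Any `K > 4` works: the excess over the Khintchine factor `2 · 2` pays for `δ`.
  refine ⟨5, by norm_num, fun H _ _ _ n x y C hC h => ?_⟩
  have hne : ∀ x : Fin n → H, (diagonalHull x).Nonempty := fun x =>
    ⟨_, mem_diagonalHull x (v := 0) (by simp)⟩
  have hnn : ∀ x : Fin n → H, ∀ p ∈ diagonalHull x, ∀ k, 0 ≤ p k := fun x p hp k => by
    obtain ⟨l, -, hl⟩ := exists_list_of_mem_diagonalHull hp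
    rw [hl]
    exact List.sum_nonneg (by simp only [List.mem_map]; rintro _ ⟨v, -, rfl⟩; positivity)
  obtain ⟨t, ht, htx, hty⟩ := exists_weights_of_sum_sqrt_le (isBounded_diagonalHull x)
    (isBounded_diagonalHull y) (convex_convexHull ℝ _) (convex_convexHull ℝ _) (hne x) (hne y)
    (hnn x) (hnn y) (show 4 * C < C * 5 by linarith) fun p hp q hq => by
      obtain ⟨l, hl, hpl⟩ := exists_list_of_mem_diagonalHull hp
      obtain ⟨m, hm, hqm⟩ := exists_list_of_mem_diagonalHull hq
      simp only [hpl, hqm]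
      exact sum_sqrt_mul_sqrt_le_of_list hC.le (sum_norm_inner_mul_le h) hl hm
  have hsq : ∀ k, √(t k) ^ 2 = t k := fun k => Real.sq_sqrt (ht k).le
  refine ⟨fun k => (√(t k) : ℂ), fun k => ?_, fun u => ?_, fun u => ?_⟩
  · simpa using (Real.sqrt_pos.2 (ht k)).ne'
  · refine isBessel_smul_of_diagonalHull (fun p hp => ?_) u
    simpa [hsq] using htx p hp
  · refine isBessel_smul_of_diagonalHull (fun q hq => ?_) u
    simpa [hsq] using hty q hq
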